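/- There is a universal constant $C>0$ such that the following holds. Let $k\ge 2$ be an integer, and for $u\in\mathbb{R}^k$ put $\mathsf{Rect}(u)=(-\infty,u_1]\times\cdots\times(-\infty,u_k]$; write $\mathsf{1}_k$ for the all-ones vector in $\mathbb{R}^k$. For a $C^\infty$ function $\psi:\mathbb{R}^k\to\mathbb{R}$ put $$\|\psi^{(4)}\|_1=\sup_{a\in\mathbb{R}^k}\ \sum_{p,q,r,s=1}^{k}\bigl|\partial_p\partial_q\partial_r\partial_s\psi(a)\bigr|.$$ Let $A,B$ be random vectors in $\mathbb{R}^k$ (possibly defined on different probability spaces), let $\Delta\in\mathbb{R}$, and let $g_k:[0,1]\to[0,1]$ be a function such that 1. for every $C^\infty$ function $\psi:\mathbb{R}^k\to\mathbb{R}$ with $\|\psi^{(4)}\|_1<\infty$ for which $\psi(A)$ and $\psi(B)$ are integrable, $\bigl|\mathbb{E}[\psi(A)]-\mathbb{E}[\psi(B)]\bigr|\le\Delta\,\|\psi^{(4)}\|_1$; 2. for every $\lambda\in[0,1]$, $\sup_{\theta\in\mathbb{R}^k}\Pr\bigl[B\in\mathsf{Rect}(\theta+\lambda\mathsf{1}_k)\setminus\mathsf{Rect}(\theta)\bigr]\le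 g_k(\lambda)$. Then for all $\theta\in\mathbb{R}^k$ and all $0<\lambda<1$, $$\bigl|\Pr[A\in\mathsf{Rect}(\theta)]-\Pr[B\in\mathsf{Rect}(\theta)]\bigr|\le \frac{C\,\Delta\,\log^3 k}{\lambda^4}+C\,g_k(\lambda).$$ -/

import Mathlib

open MeasureTheory

noncomputable section

namespace SmoothToRect

/-- The rectangle `(-∞, u₁] × ⋯ × (-∞, u_k]`. -/
def rect {k : ℕ} (u : Fin k → ℝ) : Set (Fin k → ℝ) :=
  {x | ∀ p, x p ≤ u p}

/-- The partial derivative `∂_p f`, as a function on `ℝ^k`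
(it is only applied to smooth functions). -/
def partialDeriv {k : ℕ} (p : Fin k) (f : (Fin k → ℝ) → ℝ) : (Fin k → ℝ) → ℝ :=
  fun x => fderiv ℝ f x (Pi.single p 1)

/-- The sum `∑_{p,q,r,s} |∂_p ∂_q ∂_r ∂_s ψ (a)|`. -/
def fourthDerivSum {k : ℕ} (ψ : (Fin k → ℝ) → ℝ) (a : Fin k → ℝ) : ℝ :=
  ∑ p, ∑ q, ∑ r, ∑ s,
    |partialDeriv p (partialDeriv q (partialDeriv r (partialDeriv s ψ))) a|

/-- The quantity `‖ψ⁽⁴⁾‖₁ = sup_a ∑_{p,q,r,s} |∂_p ∂_q ∂_r ∂_s ψ (a)|`; a real supremum, which is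
the honest one for the functions satisfying `IsSmoothTest`. -/
def fourthDerivNorm {k : ℕ} (ψ : (Fin k → ℝ) → ℝ) : ℝ :=
  ⨆ a, fourthDerivSum ψ a

open scoped ContDiff in
/-- A smooth test function: `C^∞`, with `‖ψ⁽⁴⁾‖₁ < ∞`. -/
def IsSmoothTest {k : ℕ} (ψ : (Fin k → ℝ) → ℝ) : Prop :=
  ContDiff ℝ ∞ ψ ∧ BddAbove (Set.range (fourthDerivSum ψ))

end SmoothToRect

end

/-! Replace the indicator of a rectangle by a smooth function of the soft maximum `lse` with β = 2
log k / λ. Since max ≤ `lse`/β ≤ max + (log k)/β, `lse` is at most log k on the rectangle and at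
least 2 log k off its λ-enlargement. A fixed step from 1 to 0, applied to `lse` / log k, therefore
lies between the two indicators. The gradient of `lse` is β times the softmax weights, which are
positive and sum to one. Summing over coordinates thus costs no power of k, and the fourth
derivatives total O(β⁴) times a bound on the derivatives, of order at least one, of the outer
function (`derivSum_comp_lse_mul_le`). Each of these carries a factor 1 / log k, which leaves log³ k
/ λ⁴. Sandwiching at the corners θ and θ - λ then compares A with B, at the cost of one strip
probability of B each time. -/

noncomputable section

namespace SmoothToRect

variable {k : ℕ}

section Calculus

open scoped ContDiff

/-- The sum of the absolute values of all `n`-fold partial derivatives. -/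
def derivSum : ℕ → ((Fin k → ℝ) → ℝ) → (Fin k → ℝ) → ℝ
  | 0, f, a => |f a|
  | n + 1, f, a => ∑ p, derivSum n (partialDeriv p f) a

/-- The two sides differ only in the order of summation, so symmetry of mixed partials is not
needed. -/
lemma fourthDerivSum_eq_derivSum (ψ : (Fin k → ℝ) → ℝ) (a : Fin k → ℝ) :
    fourthDerivSum ψ a = derivSum 4 ψ a := by
  have comm3 : ∀ F : Fin k → Fin k → Fin k → ℝ,
      ∑ p, ∑ q, ∑ r, F p q r = ∑ r, ∑ q, ∑ p, F p q r := by
    intro F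
    calc ∑ p, ∑ q, ∑ r, F p q r = ∑ p, ∑ r, ∑ q, F p q r :=
          Finset.sum_congr rfl fun p _ => Finset.sum_comm
      _ = ∑ r, ∑ p, ∑ q, F p q r := Finset.sum_comm
      _ = _ := Finset.sum_congr rfl fun r _ => Finset.sum_comm
  simp only [fourthDerivSum, derivSum]
  calc _ = ∑ p, ∑ s, ∑ r, ∑ q,
        |partialDeriv p (partialDeriv q (partialDeriv r (partialDeriv s ψ))) a| :=
        Finset.sum_congr rfl fun p _ => comm3 _
    _ = ∑ s, ∑ p, ∑ r, ∑ q,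
        |partialDeriv p (partialDeriv q (partialDeriv r (partialDeriv s ψ))) a| :=
        Finset.sum_comm
    _ = _ := Finset.sum_congr rfl fun s _ => by
        rw [Finset.sum_comm]
        exact Finset.sum_congr rfl fun r _ => Finset.sum_comm

lemma contDiff_partialDeriv {f : (Fin k → ℝ) → ℝ} (hf : ContDiff ℝ ∞ f) (p : Fin k) :
    ContDiff ℝ ∞ (partialDeriv p f) :=
  (hf.fderiv_right (m := ∞) (by simp)).clm_apply contDiff_const

lemma derivSum_add_le (n : ℕ) {f g : (Fin k → ℝ) → ℝ} (hf : ContDiff ℝ ∞ f)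
    (hg : ContDiff ℝ ∞ g) (a : Fin k → ℝ) :
    derivSum n (fun x => f x + g x) a ≤ derivSum n f a + derivSum n g a := by
  induction n generalizing f g with
  | zero => exact abs_add_le _ _
  | succ n ih =>
    simp only [derivSum, ← Finset.sum_add_distrib]
    refine Finset.sum_le_sum fun p _ => ?_
    have h : partialDeriv p (fun x => f x + g x)
        = fun x => partialDeriv p f x + partialDeriv p g x := by
      funext x
      simp only [partialDeriv]
      rw [fderiv_fun_add (hf.differentiable (by simp) x) (hg.differentiable (by simp) x)]
      rfl
    rw [h]
    exact ih (contDiff_partialDeriv hf p) (contDiff_partialDeriv hg p)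

lemma derivSum_const_mul (n : ℕ) (c : ℝ) {f : (Fin k → ℝ) → ℝ} (hf : ContDiff ℝ ∞ f)
    (a : Fin k → ℝ) : derivSum n (fun x => c * f x) a = |c| * derivSum n f a := by
  induction n generalizing f with
  | zero => exact abs_mul _ _
  | succ n ih =>
    simp only [derivSum, Finset.mul_sum]
    refine Finset.sum_congr rfl fun p _ => ?_
    have h : partialDeriv p (fun x => c * f x) = fun x => c * partialDeriv p f x := by
      funext x
      simp only [partialDeriv]
      rw [fderiv_const_mul (hf.differentiable (by simp) x)]
      rfl
    rw [h, ih (contDiff_partialDeriv hf p)]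

/-! ### Derivatives of the soft maximum and of softmax monomials -/

/-- The soft maximum `log ∑ exp (β (x_i - θ_i))`. -/
def lse (β : ℝ) (θ x : Fin k → ℝ) : ℝ := Real.log (∑ i, Real.exp (β * (x i - θ i)))

/-- The monomial with exponents `m` in the softmax weights
`exp (β (x_i - θ_i)) / ∑ exp (β (x_j - θ_j))`. -/
def softmaxMonomial (β : ℝ) (θ : Fin k → ℝ) (m : Fin k → ℕ) (x : Fin k → ℝ) : ℝ :=
  Real.exp (∑ i, m i * (β * (x i - θ i)) - (∑ i, m i : ℕ) * lse β θ x)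

lemma sum_exp_pos [NeZero k] (β : ℝ) (θ x : Fin k → ℝ) :
    0 < ∑ i, Real.exp (β * (x i - θ i)) :=
  Finset.sum_pos (fun _ _ => Real.exp_pos _) Finset.univ_nonempty

lemma contDiff_lse [NeZero k] (β : ℝ) (θ : Fin k → ℝ) : ContDiff ℝ ∞ (lse β θ) := by
  unfold lse
  refine ContDiff.log ?_ fun x => (sum_exp_pos β θ x).ne'
  fun_prop

lemma contDiff_softmaxMonomial [NeZero k] (β : ℝ) (θ : Fin k → ℝ) (m : Fin k → ℕ) :
    ContDiff ℝ ∞ (softmaxMonomial β θ m) := by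
  have := contDiff_lse β θ
  unfold softmaxMonomial
  fun_prop

lemma softmaxMonomial_add (β : ℝ) (θ : Fin k → ℝ) (m m' : Fin k → ℕ) (x : Fin k → ℝ) :
    softmaxMonomial β θ (m + m') x = softmaxMonomial β θ m x * softmaxMonomial β θ m' x := by
  simp only [softmaxMonomial, ← Real.exp_add, Pi.add_apply, Finset.sum_add_distrib,
    Nat.cast_add, add_mul]
  congr 1
  ring

lemma softmaxMonomial_single [NeZero k] (β : ℝ) (θ : Fin k → ℝ) (p : Fin k) (x : Fin k → ℝ) :
    softmaxMonomial β θ (Pi.single p 1) x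
      = Real.exp (β * (x p - θ p)) / ∑ i, Real.exp (β * (x i - θ i)) := by
  have h : ∑ i, ((Pi.single p 1 : Fin k → ℕ) i : ℝ) * (β * (x i - θ i)) = β * (x p - θ p) := by
    rw [Finset.sum_eq_single p] <;> simp +contextual
  rw [softmaxMonomial, h, Real.exp_sub, Finset.sum_pi_single', if_pos (Finset.mem_univ p),
    Nat.cast_one, one_mul, lse, Real.exp_log (sum_exp_pos β θ x)]

lemma sum_softmaxMonomial_single [NeZero k] (β : ℝ) (θ x : Fin k → ℝ) :
    ∑ p, softmaxMonomial β θ (Pi.single p 1) x = 1 := by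
  simp only [softmaxMonomial_single, ← Finset.sum_div]
  exact div_self (sum_exp_pos β θ x).ne'

lemma hasFDerivAt_coord (β : ℝ) (θ x : Fin k → ℝ) (i : Fin k) :
    HasFDerivAt (fun x : Fin k → ℝ => β * (x i - θ i))
      (β • (ContinuousLinearMap.proj i : (Fin k → ℝ) →L[ℝ] ℝ)) x :=
  ((hasFDerivAt_apply i x).sub_const (θ i)).const_mul β

lemma fderiv_lse_single [NeZero k] (β : ℝ) (θ x : Fin k → ℝ) (p : Fin k) :
    fderiv ℝ (lse β θ) x (Pi.single p 1) = β * softmaxMonomial β θ (Pi.single p 1) x := by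
  have h := (HasFDerivAt.fun_sum (u := Finset.univ)
    fun i _ => (hasFDerivAt_coord β θ x i).exp).log (sum_exp_pos β θ x).ne'
  have h' : HasFDerivAt (lse β θ) _ x := h
  rw [h'.fderiv, softmaxMonomial_single]
  simp only [smul_apply, sum_apply,
    ContinuousLinearMap.proj_apply, smul_eq_mul, Pi.single_apply]
  simp
  ring

lemma fderiv_softmaxMonomial_single [NeZero k] (β : ℝ) (θ : Fin k → ℝ) (m : Fin k → ℕ)
    (x : Fin k → ℝ) (p : Fin k) :
    fderiv ℝ (softmaxMonomial β θ m) x (Pi.single p 1)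
      = β * (m p * softmaxMonomial β θ m x
        - (∑ i, m i : ℕ) * softmaxMonomial β θ (m + Pi.single p 1) x) := by
  have h := (((HasFDerivAt.fun_sum (u := Finset.univ)
    fun i _ => (hasFDerivAt_coord β θ x i).const_mul (m i : ℝ))).sub
      (((contDiff_lse β θ).differentiable (by simp) x).hasFDerivAt.const_mul
        ((∑ i, m i : ℕ) : ℝ))).exp
  have h' : HasFDerivAt (softmaxMonomial β θ m) _ x := h
  have hs : ∑ i, (m i : ℝ) * (β * (if i = p then (1 : ℝ) else 0)) = m p * β := by
    simp
  rw [h'.fderiv, softmaxMonomial_add]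
  simp only [smul_apply, sum_apply,
    sub_apply,
    ContinuousLinearMap.proj_apply, smul_eq_mul, fderiv_lse_single, Pi.single_apply, hs]
  change softmaxMonomial β θ m x * _ = _
  ring

lemma partialDeriv_comp_lse [NeZero k] (β : ℝ) (θ : Fin k → ℝ) {G : ℝ → ℝ}
    (hG : ContDiff ℝ ∞ G) (p : Fin k) :
    partialDeriv p (fun x => G (lse β θ x))
      = fun x => β * (deriv G (lse β θ x) * softmaxMonomial β θ (Pi.single p 1) x) := by
  funext x
  have h := (hG.differentiable (by simp) (lse β θ x)).hasDerivAt.comp_hasFDerivAt x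
    ((contDiff_lse β θ).differentiable (by simp) x).hasFDerivAt
  have h' : HasFDerivAt (fun x => G (lse β θ x)) _ x := h
  rw [partialDeriv, h'.fderiv, smul_apply, fderiv_lse_single, smul_eq_mul]
  ring

lemma partialDeriv_comp_lse_mul [NeZero k] (β : ℝ) (θ : Fin k → ℝ) {G : ℝ → ℝ}
    (hG : ContDiff ℝ ∞ G) (m : Fin k → ℕ) (p : Fin k) :
    partialDeriv p (fun x => G (lse β θ x) * softmaxMonomial β θ m x)
      = fun x => β * ((deriv G (lse β θ x) - (∑ i, m i : ℕ) * G (lse β θ x))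
            * softmaxMonomial β θ (m + Pi.single p 1) x)
          + β * m p * (G (lse β θ x) * softmaxMonomial β θ m x) := by
  funext x
  have hd : DifferentiableAt ℝ (fun x => G (lse β θ x)) x :=
    (hG.comp (contDiff_lse β θ)).differentiable (by simp) x
  have h1 := congrFun (partialDeriv_comp_lse β θ hG p) x
  rw [partialDeriv] at h1
  rw [partialDeriv, fderiv_fun_mul hd ((contDiff_softmaxMonomial β θ m).differentiable (by simp) x)]
  simp only [add_apply, smul_apply, smul_eq_mul, h1,
    fderiv_softmaxMonomial_single, softmaxMonomial_add]
  ring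

/-- The combinatorial constant in `derivSum_comp_lse_mul_le`. -/
def derivConst : ℕ → ℕ → ℝ
  | 0, _ => 1
  | n + 1, d => (1 + d) * derivConst n (d + 1) + d * derivConst n d

lemma derivConst_nonneg (n d : ℕ) : 0 ≤ derivConst n d := by
  induction n generalizing d with
  | zero => exact zero_le_one
  | succ n ih =>
    have := ih d
    have := ih (d + 1)
    rw [derivConst]
    positivity

/-- One differentiation of a degree-d term yields terms of degrees d + 1 and d. Summed over p, the
first has its extra weight total 1 and the second has `m p` total d, so no dimension factor appears.
-/
lemma derivSum_comp_lse_mul_le [NeZero k] {β : ℝ} (hβ : 0 ≤ β) (θ : Fin k → ℝ) (n : ℕ)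
    {G : ℝ → ℝ} (hG : ContDiff ℝ ∞ G) {c : ℝ} (hc : ∀ j ≤ n, ∀ t, |iteratedDeriv j G t| ≤ c)
    (m : Fin k → ℕ) (a : Fin k → ℝ) :
    derivSum n (fun x => G (lse β θ x) * softmaxMonomial β θ m x) a
      ≤ β ^ n * derivConst n (∑ i, m i) * c * softmaxMonomial β θ m a := by
  induction n generalizing G c m with
  | zero =>
    have hw : 0 < softmaxMonomial β θ m a := Real.exp_pos _
    have := hc 0 le_rfl (lse β θ a)
    simp only [derivSum, derivConst, pow_zero, one_mul, abs_mul, abs_of_pos hw]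
    exact mul_le_mul_of_nonneg_right (by simpa using this) hw.le
  | succ n ih =>
    set d := ∑ i, m i with hd
    have hG' : ContDiff ℝ ∞ (deriv G) := (contDiff_infty_iff_deriv.1 hG).2
    -- The outer function of the degree d + 1 term. It uses one derivative of `G`, hence the bound
    -- on one order fewer.
    set H : ℝ → ℝ := fun t => deriv G t - (d : ℝ) * G t with hH
    have hHs : ContDiff ℝ ∞ H := hG'.sub (contDiff_const.mul hG)
    have hHc : ∀ j ≤ n, ∀ t, |iteratedDeriv j H t| ≤ (1 + d) * c := by
      intro j hj t
      have h1 := hc (j + 1) (by omega) t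
      have h2 := hc j (by omega) t
      rw [iteratedDeriv_succ'] at h1
      have e : iteratedDeriv j H t = iteratedDeriv j (deriv G) t - d * iteratedDeriv j G t := by
        rw [hH, iteratedDeriv_fun_sub (hG'.contDiffAt.of_le (by exact_mod_cast le_top))
          ((contDiff_const.mul hG).contDiffAt.of_le (by exact_mod_cast le_top)),
          iteratedDeriv_const_mul_field]
      rw [e]
      have h3 : |(d : ℝ) * iteratedDeriv j G t| ≤ d * c := by
        rw [abs_mul, Nat.abs_cast]
        exact mul_le_mul_of_nonneg_left h2 (Nat.cast_nonneg d)
      calc _ ≤ _ := abs_sub _ _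
        _ ≤ (1 + d) * c := by linarith
    have hs : ∀ m', ContDiff ℝ ∞ (softmaxMonomial β θ m') := contDiff_softmaxMonomial β θ
    have step : ∀ p, derivSum n
        (partialDeriv p (fun x => G (lse β θ x) * softmaxMonomial β θ m x)) a
        ≤ β * (β ^ n * derivConst n (d + 1) * ((1 + d) * c)
            * (softmaxMonomial β θ m a * softmaxMonomial β θ (Pi.single p 1) a))
          + β * m p * (β ^ n * derivConst n d * c * softmaxMonomial β θ m a) := by
      intro p
      have s1 : ContDiff ℝ ∞ fun x => H (lse β θ x) * softmaxMonomial β θ (m + Pi.single p 1) x :=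
        (hHs.comp (contDiff_lse β θ)).mul (hs _)
      have s2 : ContDiff ℝ ∞ fun x => G (lse β θ x) * softmaxMonomial β θ m x :=
        (hG.comp (contDiff_lse β θ)).mul (hs _)
      have i1 := ih hHs hHc (m + Pi.single p 1)
      have i2 := ih hG (fun j hj => hc j (by omega)) m
      have hd' : ∑ i, (m + Pi.single p 1 : Fin k → ℕ) i = d + 1 := by
        simp [Finset.sum_add_distrib, hd]
      rw [hd', softmaxMonomial_add] at i1
      rw [partialDeriv_comp_lse_mul β θ hG]
      refine (derivSum_add_le n (contDiff_const.mul s1) (contDiff_const.mul s2) a).trans ?_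
      rw [derivSum_const_mul n _ s1, derivSum_const_mul n _ s2, abs_of_nonneg hβ,
        abs_of_nonneg (mul_nonneg hβ (Nat.cast_nonneg _))]
      gcongr
    rw [derivSum]
    refine (Finset.sum_le_sum fun p _ => step p).trans_eq ?_
    simp only [Finset.sum_add_distrib, ← Finset.mul_sum, ← Finset.sum_mul,
      sum_softmaxMonomial_single, derivConst]
    rw [← Nat.cast_sum, ← hd]
    ring

/-- The first derivative is taken separately so that only `deriv G`, never `G` itself, has to be
bounded; this is what saves one power of log k. -/
lemma fourthDerivSum_comp_lse_le [NeZero k] {β : ℝ} (hβ : 0 ≤ β) (θ : Fin k → ℝ)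
    {G : ℝ → ℝ} (hG : ContDiff ℝ ∞ G) {c : ℝ}
    (hc : ∀ j ≤ 3, ∀ t, |iteratedDeriv j (deriv G) t| ≤ c) (a : Fin k → ℝ) :
    fourthDerivSum (fun x => G (lse β θ x)) a ≤ β ^ 4 * derivConst 3 1 * c := by
  have hG' : ContDiff ℝ ∞ (deriv G) := (contDiff_infty_iff_deriv.1 hG).2
  rw [fourthDerivSum_eq_derivSum, derivSum]
  have step : ∀ p, derivSum 3 (partialDeriv p (fun x => G (lse β θ x))) a
      ≤ β ^ 4 * derivConst 3 1 * c * softmaxMonomial β θ (Pi.single p 1) a := by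
    intro p
    have hs : ContDiff ℝ ∞
        fun x => deriv G (lse β θ x) * softmaxMonomial β θ (Pi.single p 1) x :=
      (hG'.comp (contDiff_lse β θ)).mul (contDiff_softmaxMonomial β θ _)
    rw [partialDeriv_comp_lse β θ hG, derivSum_const_mul 3 β hs, abs_of_nonneg hβ]
    have h := derivSum_comp_lse_mul_le hβ θ 3 hG' hc (Pi.single p 1) a
    rw [Finset.sum_pi_single', if_pos (Finset.mem_univ p)] at h
    refine (mul_le_mul_of_nonneg_left h hβ).trans_eq ?_
    ring
  refine (Finset.sum_le_sum fun p _ => step p).trans_eq ?_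
  rw [← Finset.mul_sum, sum_softmaxMonomial_single, mul_one]

lemma derivSum_comp_apply (n : ℕ) {f : ℝ → ℝ} (hf : ContDiff ℝ ∞ f) (i : Fin k)
    (a : Fin k → ℝ) : derivSum n (fun x => f (x i)) a = |iteratedDeriv n f (a i)| := by
  induction n generalizing f with
  | zero => simp [derivSum]
  | succ n ih =>
    have hf' : ContDiff ℝ ∞ (deriv f) := (contDiff_infty_iff_deriv.1 hf).2
    have h : ∀ p, partialDeriv p (fun x : Fin k → ℝ => f (x i))
        = fun x => (if i = p then 1 else 0) * deriv f (x i) := by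
      intro p
      funext x
      have h2 : HasFDerivAt (fun x : Fin k → ℝ => f (x i))
          (deriv f (x i) • (ContinuousLinearMap.proj i : (Fin k → ℝ) →L[ℝ] ℝ)) x :=
        HasDerivAt.comp_hasFDerivAt (f := fun x : Fin k → ℝ => x i) x
          (hf.differentiable (by simp) (x i)).hasDerivAt (hasFDerivAt_apply i x)
      rw [partialDeriv, h2.fderiv]
      simp [Pi.single_apply]
    have hs : ContDiff ℝ ∞ fun x : Fin k → ℝ => deriv f (x i) := hf'.comp (contDiff_apply ℝ ℝ i)
    simp only [derivSum, h]
    simp only [derivSum_const_mul n _ hs, ih hf']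
    rw [iteratedDeriv_succ', Finset.sum_eq_single i] <;> simp +contextual [eq_comm]

lemma iteratedDeriv_four_cos : iteratedDeriv 4 Real.cos = Real.cos := by
  funext x
  simp

/-! ### The step function and the smoothed rectangle -/

/-- The smooth decreasing step from `1` on `(-∞, 1]` to `0` on `[2, ∞)`. -/
def smoothStep (t : ℝ) : ℝ := Real.smoothTransition (2 - t)

lemma contDiff_smoothStep : ContDiff ℝ ∞ smoothStep :=
  Real.smoothTransition.contDiff.comp (contDiff_const.sub contDiff_id)

lemma hasCompactSupport_iteratedDeriv_succ_smoothStep (j : ℕ) :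
    HasCompactSupport (iteratedDeriv (j + 1) smoothStep) := by
  induction j with
  | zero =>
    refine HasCompactSupport.intro (isCompact_Icc (a := (1 : ℝ)) (b := 2)) fun t ht => ?_
    rw [zero_add, iteratedDeriv_one]
    rcases lt_or_ge t 1 with h | h
    · have : smoothStep =ᶠ[nhds t] fun _ => 1 := by
        filter_upwards [Iio_mem_nhds h] with s hs
        exact Real.smoothTransition.one_of_one_le (by linarith [Set.mem_Iio.1 hs])
      rw [this.deriv_eq, deriv_const]
    · have h2 : 2 < t := by
        by_contra! h'
        exact ht ⟨h, h'⟩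
      have : smoothStep =ᶠ[nhds t] fun _ => 0 := by
        filter_upwards [Ioi_mem_nhds h2] with s hs
        exact Real.smoothTransition.zero_of_nonpos (by linarith [Set.mem_Ioi.1 hs])
      rw [this.deriv_eq, deriv_const]
  | succ j ih =>
    rw [iteratedDeriv_succ]
    exact ih.deriv

lemma exists_bound_iteratedDeriv_succ_smoothStep (n : ℕ) :
    ∃ M, 0 < M ∧ ∀ j ≤ n, ∀ t, |iteratedDeriv (j + 1) smoothStep t| ≤ M := by
  have h : ∀ j, ∃ M, ∀ t, |iteratedDeriv (j + 1) smoothStep t| ≤ M := fun j =>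
    (hasCompactSupport_iteratedDeriv_succ_smoothStep j).exists_bound_of_continuous
      (contDiff_smoothStep.continuous_iteratedDeriv (j + 1) (by exact_mod_cast le_top))
  choose M hM using h
  have hM0 : ∀ j, 0 ≤ M j := fun j => (abs_nonneg _).trans (hM j 0)
  refine ⟨∑ j ∈ Finset.range (n + 1), M j + 1,
    add_pos_of_nonneg_of_pos (Finset.sum_nonneg fun j _ => hM0 j) one_pos, fun j hj t => ?_⟩
  have := Finset.single_le_sum (f := M) (fun j _ => hM0 j)
    (Finset.mem_range.2 (Nat.lt_succ_of_le hj))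
  linarith [hM j t]

/-- The chain rule gives `L⁻¹ ^ (j + 1)`. One factor is kept and the others are at most 2 each. -/
lemma abs_iteratedDeriv_deriv_smoothStep_comp_le {M : ℝ} {n : ℕ}
    (hM : ∀ j ≤ n, ∀ t, |iteratedDeriv (j + 1) smoothStep t| ≤ M) {L : ℝ} (hL : 1 / 2 ≤ L)
    (j : ℕ) (hj : j ≤ n) (t : ℝ) :
    |iteratedDeriv j (deriv fun u => smoothStep (L⁻¹ * u)) t| ≤ 2 ^ n * M / L := by
  have hL0 : 0 < L := by linarith
  rw [← iteratedDeriv_succ', iteratedDeriv_comp_const_mul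
    (contDiff_smoothStep.of_le (by exact_mod_cast le_top))]
  simp only [abs_mul, abs_pow, abs_inv, abs_of_pos hL0]
  have h2 : L⁻¹ ≤ 2 := by
    rw [inv_le_comm₀ hL0 two_pos]
    linarith
  have h3 : L⁻¹ ^ j ≤ 2 ^ n :=
    (pow_le_pow_left₀ (by positivity) h2 j).trans (pow_le_pow_right₀ one_le_two hj)
  calc L⁻¹ ^ (j + 1) * |iteratedDeriv (j + 1) smoothStep (L⁻¹ * t)|
      = L⁻¹ ^ j * |iteratedDeriv (j + 1) smoothStep (L⁻¹ * t)| * L⁻¹ := by ring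
    _ ≤ 2 ^ n * M * L⁻¹ := by
        gcongr
        exact hM j hj _
    _ = _ := rfl

/-- The smooth approximation, at scale `lam`, of the indicator of `rect θ`. -/
def smoothRect (θ : Fin k → ℝ) (lam : ℝ) (x : Fin k → ℝ) : ℝ :=
  smoothStep ((Real.log k)⁻¹ * lse (2 * Real.log k / lam) θ x)

lemma half_le_log {k : ℕ} (hk : 2 ≤ k) : 1 / 2 ≤ Real.log k := by
  have h2 : (2 : ℝ) ≤ k := by exact_mod_cast hk
  linarith [Real.log_two_gt_d9, Real.log_le_log two_pos h2]

lemma contDiff_smoothRect [NeZero k] (θ : Fin k → ℝ) (lam : ℝ) :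
    ContDiff ℝ ∞ (smoothRect θ lam) :=
  contDiff_smoothStep.comp (contDiff_const.mul (contDiff_lse _ θ))

lemma smoothRect_nonneg (θ : Fin k → ℝ) (lam : ℝ) (x : Fin k → ℝ) : 0 ≤ smoothRect θ lam x :=
  Real.smoothTransition.nonneg _

lemma smoothRect_le_one (θ : Fin k → ℝ) (lam : ℝ) (x : Fin k → ℝ) : smoothRect θ lam x ≤ 1 :=
  Real.smoothTransition.le_one _

lemma smoothRect_eq_one (hk : 2 ≤ k) {θ : Fin k → ℝ} {lam : ℝ} (hlam : 0 < lam)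
    {x : Fin k → ℝ} (hx : x ∈ rect θ) : smoothRect θ lam x = 1 := by
  have : NeZero k := ⟨by omega⟩
  have hL := half_le_log hk
  have hL0 : 0 < Real.log k := by linarith
  have h : lse (2 * Real.log k / lam) θ x ≤ Real.log k := by
    refine Real.log_le_log (sum_exp_pos _ _ _) ?_
    calc ∑ i, Real.exp (2 * Real.log k / lam * (x i - θ i)) ≤ ∑ _i : Fin k, (1 : ℝ) := by
          refine Finset.sum_le_sum fun i _ => Real.exp_le_one_iff.2 ?_
          exact mul_nonpos_of_nonneg_of_nonpos (by positivity) (sub_nonpos.2 (hx i))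
      _ = k := by simp
  refine Real.smoothTransition.one_of_one_le ?_
  have : (Real.log k)⁻¹ * lse (2 * Real.log k / lam) θ x ≤ 1 := by
    rw [inv_mul_le_iff₀ hL0]
    simpa using h
  linarith

lemma smoothRect_eq_zero (hk : 2 ≤ k) {θ : Fin k → ℝ} {lam : ℝ} (hlam : 0 < lam)
    {x : Fin k → ℝ} (hx : x ∉ rect fun p => θ p + lam) : smoothRect θ lam x = 0 := by
  have hL := half_le_log hk
  have hL0 : 0 < Real.log k := by linarith
  simp only [rect, Set.mem_ofPred_eq, not_forall, not_le] at hx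
  obtain ⟨p, hp⟩ := hx
  have h : 2 * Real.log k ≤ lse (2 * Real.log k / lam) θ x := by
    have h1 : Real.exp (2 * Real.log k / lam * (x p - θ p))
        ≤ ∑ i, Real.exp (2 * Real.log k / lam * (x i - θ i)) :=
      Finset.single_le_sum (f := fun i => Real.exp (2 * Real.log k / lam * (x i - θ i)))
        (fun i _ => (Real.exp_pos _).le) (Finset.mem_univ p)
    have h2 := Real.log_le_log (Real.exp_pos _) h1
    rw [Real.log_exp] at h2
    refine le_trans ?_ h2
    calc 2 * Real.log k = 2 * Real.log k / lam * lam := by field_simp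
      _ ≤ _ := by
        gcongr
        linarith
  refine Real.smoothTransition.zero_of_nonpos ?_
  have : 2 ≤ (Real.log k)⁻¹ * lse (2 * Real.log k / lam) θ x := by
    rw [le_inv_mul_iff₀ hL0]
    linarith
  linarith

/-- The bound on the fourth derivatives is uniform in the dimension, the corner and the scale. -/
lemma exists_fourthDerivSum_smoothRect_le :
    ∃ C : ℝ, 0 < C ∧ ∀ (k : ℕ), 2 ≤ k → ∀ (θ : Fin k → ℝ) (lam : ℝ), 0 < lam →
      ∀ a, fourthDerivSum (smoothRect θ lam) a ≤ C * (Real.log k ^ 3 / lam ^ 4) := by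
  obtain ⟨M, hM0, hM⟩ := exists_bound_iteratedDeriv_succ_smoothStep 3
  have hK : 0 ≤ derivConst 3 1 := derivConst_nonneg 3 1
  -- 2⁷ is 2⁴ from β⁴ times 2³ from the rescaled step; the + 1 ensures positivity.
  refine ⟨2 ^ 7 * derivConst 3 1 * M + 1, by positivity, fun k hk θ lam hlam a => ?_⟩
  have : NeZero k := ⟨by omega⟩
  have hL := half_le_log hk
  have hL0 : 0 < Real.log k := by linarith
  have h := fourthDerivSum_comp_lse_le (k := k) (β := 2 * Real.log k / lam) (by positivity) θ
    (G := fun u => smoothStep ((Real.log k)⁻¹ * u))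
    (contDiff_smoothStep.comp (contDiff_const.mul contDiff_id))
    (abs_iteratedDeriv_deriv_smoothStep_comp_le hM hL) a
  calc fourthDerivSum (smoothRect θ lam) a
      ≤ (2 * Real.log k / lam) ^ 4 * derivConst 3 1 * (2 ^ 3 * M / Real.log k) := h
    _ = 2 ^ 7 * derivConst 3 1 * M * (Real.log k ^ 3 / lam ^ 4) := by
        field_simp
    _ ≤ _ := by
        gcongr
        linarith

end Calculus

/-! ### Sandwiching probabilities between expectations -/

lemma measurableSet_rect (θ : Fin k → ℝ) : MeasurableSet (rect θ) := by
  have : rect θ = Set.Iic θ := rfl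
  rw [this]
  exact measurableSet_Iic

section Expectation

variable {Ω : Type*} [MeasurableSpace Ω] {P : Measure Ω} {A : Ω → Fin k → ℝ}

lemma integral_indicator_rect (hA : AEMeasurable A P) (θ : Fin k → ℝ) :
    ∫ ω, (A ⁻¹' rect θ).indicator (fun _ => (1 : ℝ)) ω ∂P = P.real {ω | A ω ∈ rect θ} := by
  rw [integral_indicator₀ (hA.nullMeasurableSet_preimage (measurableSet_rect θ))]
  simp
  rfl

variable [IsProbabilityMeasure P]

lemma integrable_comp_of_bounded (hA : AEMeasurable A P) {ψ : (Fin k → ℝ) → ℝ}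
    (hψ : Continuous ψ) {c : ℝ} (hc : ∀ x, |ψ x| ≤ c) : Integrable (fun ω => ψ (A ω)) P :=
  Integrable.of_bound (hψ.measurable.comp_aemeasurable hA).aestronglyMeasurable c
    (Filter.Eventually.of_forall fun ω => hc (A ω))

lemma integrable_smoothRect [NeZero k] (hA : AEMeasurable A P) (θ : Fin k → ℝ) (lam : ℝ) :
    Integrable (fun ω => smoothRect θ lam (A ω)) P :=
  integrable_comp_of_bounded hA (contDiff_smoothRect θ lam).continuous (c := 1) fun x => by
    rw [abs_of_nonneg (smoothRect_nonneg θ lam x)]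
    exact smoothRect_le_one θ lam x

lemma integrable_indicator_rect (hA : AEMeasurable A P) (θ : Fin k → ℝ) :
    Integrable ((A ⁻¹' rect θ).indicator fun _ => (1 : ℝ)) P :=
  (integrable_const 1).indicator₀ (hA.nullMeasurableSet_preimage (measurableSet_rect θ))

lemma measureReal_rect_le_integral (hk : 2 ≤ k) (hA : AEMeasurable A P) (θ : Fin k → ℝ)
    {lam : ℝ} (hlam : 0 < lam) :
    P.real {ω | A ω ∈ rect θ} ≤ ∫ ω, smoothRect θ lam (A ω) ∂P := by
  have : NeZero k := ⟨by omega⟩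
  rw [← integral_indicator_rect hA]
  refine integral_mono (integrable_indicator_rect hA θ) (integrable_smoothRect hA θ lam)
    fun ω => Set.indicator_le' (fun ω hω => ?_) (fun ω _ => smoothRect_nonneg _ _ _) ω
  exact (smoothRect_eq_one hk hlam hω).ge

lemma integral_le_measureReal_rect (hk : 2 ≤ k) (hA : AEMeasurable A P) (θ : Fin k → ℝ)
    {lam : ℝ} (hlam : 0 < lam) :
    ∫ ω, smoothRect θ lam (A ω) ∂P ≤ P.real {ω | A ω ∈ rect fun p => θ p + lam} := by
  have : NeZero k := ⟨by omega⟩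
  rw [← integral_indicator_rect hA]
  refine integral_mono (integrable_smoothRect hA θ lam) (integrable_indicator_rect hA _)
    fun ω => Set.le_indicator (f := fun ω => smoothRect θ lam (A ω))
      (fun ω _ => smoothRect_le_one _ _ _) (fun ω hω => ?_) ω
  exact (smoothRect_eq_zero hk hlam hω).le

lemma measureReal_rect_add_le (θ : Fin k → ℝ) (lam : ℝ) :
    P.real {ω | A ω ∈ rect fun p => θ p + lam} ≤ P.real {ω | A ω ∈ rect θ}
      + P.real {ω | A ω ∈ rect (fun p => θ p + lam) \ rect θ} := by
  refine (measureReal_mono fun ω hω => ?_).trans (measureReal_union_le _ _)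
  by_cases h : A ω ∈ rect θ
  · exact Or.inl h
  · exact Or.inr ⟨hω, h⟩

end Expectation

lemma fourthDerivSum_cos_apply (i : Fin k) (a : Fin k → ℝ) :
    fourthDerivSum (fun x => Real.cos (x i)) a = |Real.cos (a i)| := by
  rw [fourthDerivSum_eq_derivSum, derivSum_comp_apply 4 Real.contDiff_cos, iteratedDeriv_four_cos]

end SmoothToRect

end

open SmoothToRect in
theorem lemma3p3 :
    ∃ C : ℝ, 0 < C ∧
      ∀ (k : ℕ), 2 ≤ k →
      ∀ (Ω : Type*) [MeasurableSpace Ω] (P : Measure Ω) [IsProbabilityMeasure P]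
        (Ω' : Type*) [MeasurableSpace Ω'] (P' : Measure Ω') [IsProbabilityMeasure P']
        (A : Ω → Fin k → ℝ) (B : Ω' → Fin k → ℝ),
        AEMeasurable A P → AEMeasurable B P' →
      ∀ (Δ : ℝ) (g : Set.Icc (0 : ℝ) 1 → Set.Icc (0 : ℝ) 1),
        (∀ ψ : (Fin k → ℝ) → ℝ, SmoothToRect.IsSmoothTest ψ →
          Integrable (fun ω => ψ (A ω)) P → Integrable (fun ω => ψ (B ω)) P' →
          |(∫ ω, ψ (A ω) ∂P) - ∫ ω, ψ (B ω) ∂P'| ≤ Δ * SmoothToRect.fourthDerivNorm ψ) →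
        (∀ (lam : Set.Icc (0 : ℝ) 1) (θ : Fin k → ℝ),
          P'.real {ω | B ω ∈ SmoothToRect.rect (fun p => θ p + (lam : ℝ)) \ SmoothToRect.rect θ}
            ≤ (g lam : ℝ)) →
      ∀ (θ : Fin k → ℝ) (lam : Set.Icc (0 : ℝ) 1), 0 < (lam : ℝ) → (lam : ℝ) < 1 →
        |P.real {ω | A ω ∈ SmoothToRect.rect θ} - P'.real {ω | B ω ∈ SmoothToRect.rect θ}|
          ≤ C * Δ * Real.log k ^ 3 / (lam : ℝ) ^ 4 + C * (g lam : ℝ) := by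
  obtain ⟨C, hC0, hC⟩ := exists_fourthDerivSum_smoothRect_le
  refine ⟨C + 1, by positivity, ?_⟩
  intro k hk Ω _ P _ Ω' _ P' _ A B hA hB Δ g hψ hg θ lam hlam _
  have : NeZero k := ⟨by omega⟩
  have hL0 : 0 < Real.log k := by linarith [half_le_log hk]
  -- Needed to replace the norm by its upper bound. The test function cos x₀ has positive norm,
  -- because the fourth derivative of cos is cos.
  have hΔ : 0 ≤ Δ := by
    have hbdd : BddAbove (Set.range
        (fourthDerivSum fun x : Fin k → ℝ => Real.cos (x 0))) := by
      refine ⟨1, ?_⟩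
      rintro _ ⟨a, rfl⟩
      rw [fourthDerivSum_cos_apply]
      exact Real.abs_cos_le_one _
    have hcont : Continuous fun x : Fin k → ℝ => Real.cos (x 0) :=
      Real.continuous_cos.comp (continuous_apply 0)
    have h := (abs_nonneg _).trans (hψ (fun x => Real.cos (x 0))
      ⟨Real.contDiff_cos.comp (contDiff_apply ℝ ℝ 0), hbdd⟩
      (integrable_comp_of_bounded hA hcont fun x => Real.abs_cos_le_one _)
      (integrable_comp_of_bounded hB hcont fun x => Real.abs_cos_le_one _))
    refine nonneg_of_mul_nonneg_left h ?_
    refine lt_of_lt_of_le one_pos (le_trans ?_ (le_ciSup hbdd 0))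
    rw [fourthDerivSum_cos_apply]
    simp
  have key : ∀ θ' : Fin k → ℝ, |(∫ ω, smoothRect θ' lam (A ω) ∂P)
      - ∫ ω, smoothRect θ' lam (B ω) ∂P'| ≤ C * Δ * Real.log k ^ 3 / (lam : ℝ) ^ 4 := by
    intro θ'
    have hb := hC k hk θ' lam hlam
    refine (hψ _ ⟨contDiff_smoothRect θ' lam, ⟨_, by rintro _ ⟨a, rfl⟩; exact hb a⟩⟩
      (integrable_smoothRect hA θ' lam) (integrable_smoothRect hB θ' lam)).trans ?_
    refine (mul_le_mul_of_nonneg_left (ciSup_le hb) hΔ).trans_eq ?_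
    ring
  have hg0 : 0 ≤ (g lam : ℝ) := (g lam).2.1
  have hC1 : C * Δ * Real.log k ^ 3 / (lam : ℝ) ^ 4 + (g lam : ℝ)
      ≤ (C + 1) * Δ * Real.log k ^ 3 / (lam : ℝ) ^ 4 + (C + 1) * (g lam : ℝ) := by
    gcongr
    · linarith
    · nlinarith
  refine le_trans ?_ hC1
  -- The upper bound uses the corner θ; the lower bound uses θ - λ, whose enlargement is the
  -- rectangle at θ.
  have hshift : (fun p => (θ p - lam) + (lam : ℝ)) = θ := by
    funext p
    ring
  have u1 := measureReal_rect_le_integral hk hA θ hlam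
  have u2 := abs_le.1 (key θ)
  have u3 := integral_le_measureReal_rect hk hB θ hlam
  have u4 := measureReal_rect_add_le (P := P') (A := B) θ lam
  have u5 := hg lam θ
  have l1 := integral_le_measureReal_rect hk hA (fun p => θ p - lam) hlam
  have l2 := abs_le.1 (key fun p => θ p - lam)
  have l3 := measureReal_rect_le_integral hk hB (fun p => θ p - lam) hlam
  have l4 := measureReal_rect_add_le (P := P') (A := B) (fun p => θ p - lam) lam
  have l5 := hg lam fun p => θ p - lam
  rw [hshift] at l1 l4 l5
  rw [abs_le]
  constructor
  · linarith [u2.1, u2.2, l2.1, l2.2]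
  · linarith [u2.1, u2.2, l2.1, l2.2]
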